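/- Conventions. A family $(U_i)_{i\in I}$ of subsets of a topological space $X$ is *discrete* if every point of $X$ has a neighbourhood $V$ with $U_i\cap V\neq\emptyset$ for at most one $i\in I$. A topological space $X$ is *collectionwise normal* if it is a $T_1$-space and for every discrete collection $\mathscr D$ of closed subsets of $X$ there is a discrete family $\{U_D: D\in\mathscr D\}$ of open subsets of $X$ with $D\subset U_D$ for every $D\in\mathscr D$. For a Banach space $E$, let $\mathscr C(E)$ be the family of all nonempty compact subsets of $E$, and $\mathscr C'(E)=\mathscr C(E)\cup\{E\}$. A mapping $\varphi$ from $X$ to the nonempty subsets of $E$ is *lower semi-continuous (l.s.c.)* if $\{x\in X:\varphi(x)\cap U\neq\emptyset\}$ is open in $X$ for every open $U\subset E$; it is *convex-valued* if every $\varphi(x)$ is convex; a map $f:X\to E$ is a *selection* for $\varphi$ if $f(x)\in\varphi(x)$ for every $x\in X$. **Theorem 1.2.** For a (real) Banach space $E$, the following are equivalent: (a) If $X$ is a collectionwise normal space and $\varphi:X\to\mathscr C(E)$ is an l.s.c. convex-valued mapping, then $\varphi$ has a continuous selection. (b) If $X$ is a collectionwise normal space and $\varphi:X\to\mathscr C'(E)$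 is an l.s.c. convex-valued mapping, then $\varphi$ has a continuous selection. -/

import Mathlib

open Set Topology

universe u v

/-- An indexed family of subsets of `X` is discrete if every point of `X` has a neighbourhood
that meets at most one member of the family (counted with its index). -/
def IsDiscreteFamily {X : Type*} [TopologicalSpace X] {ι : Type*} (U : ι → Set X) : Prop :=
  ∀ x : X, ∃ V ∈ 𝓝 x, {i : ι | (U i ∩ V).Nonempty}.Subsingleton

/-- A space `X` is collectionwise normal if it is a `T₁`-space and every discrete collection `𝒟`
of closed subsets of `X` can be expanded to a discrete family `{U D : D ∈ 𝒟}` of open subsets,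
i.e. `D ⊆ U D` for every `D ∈ 𝒟`. -/
structure IsCollectionwiseNormal (X : Type*) [TopologicalSpace X] : Prop where
  t1Space : T1Space X
  exists_discrete_open_expansion : ∀ 𝒟 : Set (Set X),
    (∀ D ∈ 𝒟, IsClosed D) → IsDiscreteFamily (fun D : 𝒟 => (D : Set X)) →
      ∃ U : 𝒟 → Set X, (∀ D, IsOpen (U D)) ∧ IsDiscreteFamily U ∧ ∀ D : 𝒟, (D : Set X) ⊆ U D

/-- `𝓕(E)`: the family of all nonempty closed subsets of `E`. -/
def closedFamily (E : Type*) [TopologicalSpace E] : Set (Set E) :=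
  {S | S.Nonempty ∧ IsClosed S}

/-- `𝓒(E)`: the family of all compact members of `𝓕(E)`. -/
def compactFamily (E : Type*) [TopologicalSpace E] : Set (Set E) :=
  {S | S ∈ closedFamily E ∧ IsCompact S}

/-- `𝓒'(E) = 𝓒(E) ∪ {E}`. -/
def compactOrWholeFamily (E : Type*) [TopologicalSpace E] : Set (Set E) :=
  compactFamily E ∪ {univ}

/-- `f` is a selection for the set-valued mapping `φ` if `f x ∈ φ x` for every `x`. -/
def IsSelection {X E : Type*} (f : X → E) (φ : X → Set E) : Prop :=
  ∀ x, f x ∈ φ x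

/-! (b) holds outright, and (a) is a special case of it. Let `v` be a locally finite open cover of
`E` by small sets. The sets of `x` for which `φ x` meets `v e` form an open cover of `X`. A compact
`φ x` meets only finitely many `v e`, so every point of infinite order has `φ x = E` and lies in the
member given by the `v e₀` containing `0`.

Covers of this kind have locally finite refinements although `X` need not be paracompact: points of
finite order are handled order by order with discrete expansions, and the rest form a closed set
inside one member. A partition of unity then gives approximate selections. Working relative to a
ball around the previous one makes them uniformly Cauchy, and the limit is a selection because the
values are closed. -/

theorem IsDiscreteFamily.locallyFinite {X ι : Type*} [TopologicalSpace X] {U : ι → Set X}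
    (hU : IsDiscreteFamily U) : LocallyFinite U := fun x =>
  let ⟨V, hV, hs⟩ := hU x
  ⟨V, hV, hs.finite⟩

theorem IsDiscreteFamily.disjoint {X ι : Type*} [TopologicalSpace X] {U : ι → Set X}
    (hU : IsDiscreteFamily U) {i j : ι} (hij : i ≠ j) : Disjoint (U i) (U j) := by
  refine Set.disjoint_left.2 fun x hi hj => hij ?_
  obtain ⟨V, hV, hs⟩ := hU x
  exact hs ⟨x, hi, mem_of_mem_nhds hV⟩ ⟨x, hj, mem_of_mem_nhds hV⟩

/-! ### Expansions in collectionwise normal spaces. -/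

namespace IsCollectionwiseNormal

variable {X : Type*} [TopologicalSpace X]

/-- The expansion property for indexed families, whose empty members may repeat. -/
theorem exists_open_expansion (hX : IsCollectionwiseNormal X) {ι : Type*} {D : ι → Set X}
    (hc : ∀ i, IsClosed (D i)) (hD : IsDiscreteFamily D) :
    ∃ U : ι → Set X, (∀ i, IsOpen (U i)) ∧ IsDiscreteFamily U ∧ ∀ i, D i ⊆ U i := by
  classical
  obtain ⟨U, hUo, hUd, hUs⟩ := hX.exists_discrete_open_expansion
    {S | S.Nonempty ∧ ∃ i, D i = S} (by rintro _ ⟨-, i, rfl⟩; exact hc i) (by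
      intro x
      obtain ⟨V, hV, hs⟩ := hD x
      refine ⟨V, hV, ?_⟩
      rintro ⟨_, _, i, rfl⟩ hi ⟨_, _, j, rfl⟩ hj
      have : i = j := hs hi hj
      subst this
      rfl)
  -- Indices with empty `D i` would all share one open set; a nonempty `D i` determines `i` by
  -- disjointness.
  refine ⟨fun i => if h : (D i).Nonempty then U ⟨D i, h, i, rfl⟩ else ∅, ?_, ?_, ?_⟩
  · intro i
    dsimp only
    split_ifs with h
    · exact hUo _
    · exact isOpen_empty
  · intro x
    obtain ⟨V, hV, hs⟩ := hUd x
    refine ⟨V, hV, fun i hi j hj => ?_⟩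
    simp only [Set.mem_ofPred_eq] at hi hj
    split_ifs at hi with h
    · split_ifs at hj with h'
      · have hij : D i = D j := congrArg Subtype.val (hs hi hj)
        by_contra hne
        obtain ⟨y, hy⟩ := h
        exact Set.disjoint_left.1 (hD.disjoint hne) hy (hij ▸ hy)
      · simp at hj
    · simp at hi
  · intro i x hx
    have h : (D i).Nonempty := ⟨x, hx⟩
    simpa only [h, dif_pos] using hUs ⟨D i, h, i, rfl⟩ hx

theorem normalSpace (hX : IsCollectionwiseNormal X) : NormalSpace X where
  normal s t hs ht hst := by
    obtain ⟨U, hUo, hUd, hUs⟩ := hX.exists_open_expansion (D := fun b : Bool => cond b s t)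
      (by rintro (_ | _) <;> assumption) (by
        intro x
        by_cases hx : x ∈ s
        · refine ⟨tᶜ, ht.isOpen_compl.mem_nhds (Set.disjoint_left.1 hst hx), ?_⟩
          rintro (_ | _) ⟨y, hy, hy'⟩ (_ | _) ⟨z, hz, hz'⟩ <;> first | rfl | exact absurd hy hy' |
            exact absurd hz hz'
        · refine ⟨sᶜ, hs.isOpen_compl.mem_nhds hx, ?_⟩
          rintro (_ | _) ⟨y, hy, hy'⟩ (_ | _) ⟨z, hz, hz'⟩ <;> first | rfl | exact absurd hy hy' |
            exact absurd hz hz')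
    exact ⟨U true, U false, hUo _, hUo _, hUs true, hUs false, hUd.disjoint (by simp)⟩

/-- A discrete closed family is covered by a locally finite family of cozero sets inside a
prescribed open expansion. -/
theorem exists_continuous_expansion (hX : IsCollectionwiseNormal X) {ι : Type*}
    {D U : ι → Set X} (hc : ∀ i, IsClosed (D i)) (hD : IsDiscreteFamily D)
    (ho : ∀ i, IsOpen (U i)) (hDU : ∀ i, D i ⊆ U i) :
    ∃ f : ι → C(X, ℝ), (∀ i x, 0 ≤ f i x) ∧ (LocallyFinite fun i => Function.support (f i)) ∧
      (∀ i, Function.support (f i) ⊆ U i) ∧ ∀ i, D i ⊆ Function.support (f i) := by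
  have := hX.normalSpace
  obtain ⟨O, hOo, hOd, hOs⟩ := hX.exists_open_expansion hc hD
  have key : ∀ i, ∃ f : C(X, ℝ), EqOn f 0 (O i ∩ U i)ᶜ ∧ EqOn f 1 (D i) ∧
      ∀ x, f x ∈ Icc (0 : ℝ) 1 := fun i =>
    exists_continuous_zero_one_of_isClosed ((hOo i).inter (ho i)).isClosed_compl (hc i)
      (Set.disjoint_left.2 fun x hx hx' => hx ⟨hOs i hx', hDU i hx'⟩)
  choose f hf0 hf1 hf using key
  have hsupp : ∀ i, Function.support (f i) ⊆ O i ∩ U i := fun i x hx => by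
    by_contra h
    exact hx (hf0 i h)
  refine ⟨f, fun i x => (hf i x).1, hOd.locallyFinite.subset fun i => (hsupp i).trans
    inter_subset_left, fun i => (hsupp i).trans inter_subset_right, fun i x hx => ?_⟩
  rw [Function.mem_support, hf1 i hx]
  exact one_ne_zero

end IsCollectionwiseNormal

/-! ### Locally finite refinements and the order of a cover. -/

section Order

variable {X ι : Type*} [TopologicalSpace X] {U : ι → Set X}

/-- Lying in `n + 1` given members is an open condition. -/
theorem isClosed_setOf_encard_le (hU : ∀ i, IsOpen (U i)) (n : ℕ) :
    IsClosed {x | {i | x ∈ U i}.encard ≤ n} := by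
  rw [← isOpen_compl_iff, isOpen_iff_mem_nhds]
  intro x hx
  simp only [mem_compl_iff, Set.mem_ofPred_eq, not_le] at hx
  obtain ⟨t, ht, htn⟩ := Set.exists_subset_encard_eq (Order.add_one_le_of_lt hx)
  have htf : t.Finite := Set.finite_of_encard_eq_coe (k := n + 1) (by simpa using htn)
  filter_upwards [(htf.isOpen_biInter fun i _ => hU i).mem_nhds
    (mem_iInter₂.2 fun i hi => ht hi)] with y hy
  simp only [mem_compl_iff, Set.mem_ofPred_eq, not_le]
  refine lt_of_lt_of_le ?_ (Set.encard_le_encard (s := t) fun i hi => mem_iInter₂.1 hy i hi)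
  rw [htn]
  exact_mod_cast Nat.lt_succ_self n

/-- In a collectionwise normal space, the points of an open cover `U` of order at most `n` are
covered by a locally finite family of cozero sets refining `U`. -/
theorem IsCollectionwiseNormal.exists_cozero_cover_encard_le (hX : IsCollectionwiseNormal X)
    (hU : ∀ i, IsOpen (U i)) (hc : ⋃ i, U i = univ) (n : ℕ) :
    ∃ f : Finset ι → C(X, ℝ), (∀ s x, 0 ≤ f s x) ∧
      (LocallyFinite fun s => Function.support (f s)) ∧
      (∀ s, Function.support (f s) ⊆ {x | s.Nonempty ∧ ∀ i ∈ s, x ∈ U i}) ∧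
      {x | {i | x ∈ U i}.encard ≤ n} ⊆ ⋃ s, Function.support (f s) := by
  induction n with
  | zero =>
    refine ⟨fun _ => 0, fun _ _ => le_rfl, fun x => ⟨univ, Filter.univ_mem, by simp⟩, by simp, ?_⟩
    intro x hx
    obtain ⟨i, hi⟩ := mem_iUnion.1 (hc.ge (mem_univ x))
    have : {i | x ∈ U i} = ∅ := by simpa using hx
    exact absurd (show i ∈ {i | x ∈ U i} from hi) (by simp [this])
  | succ n ih =>
    obtain ⟨f, hf0, hflf, hfs, hfc⟩ := ih
    set O : Set X := ⋃ s, Function.support (f s) with hO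
    have hOo : IsOpen O := isOpen_iUnion fun s => isOpen_ne_fun (f s).continuous continuous_const
    set C : Set X := {x | {i | x ∈ U i}.encard ≤ (n + 1 : ℕ)} ∩ Oᶜ with hC
    have hCc : IsClosed C := (isClosed_setOf_encard_le hU (n + 1)).inter hOo.isClosed_compl
    have hcard : ∀ x ∈ C, {i | x ∈ U i}.encard = (n + 1 : ℕ) := by
      rintro x ⟨hx, hxO⟩
      refine le_antisymm hx ?_
      have h : ¬ {i | x ∈ U i}.encard ≤ (n : ℕ) := fun h => hxO (hfc h)
      simpa using Order.add_one_le_of_lt (not_le.1 h)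
    have hfin : ∀ x ∈ C, ∃ s : Finset ι, {i | x ∈ U i} = s := fun x hx =>
      ⟨(Set.finite_of_encard_eq_coe (hcard x hx)).toFinset, by simp⟩
    -- All points of `C` have order exactly `n + 1`. If `x ∈ D s`, a point of `C` in `⋂ i ∈ s, U i`
    -- has an index set containing `s` and of the same size, hence equal to `s`; so `D` is discrete.
    let D : Finset ι → Set X := fun s => {x ∈ C | {i | x ∈ U i} = s}
    have hloc : ∀ x ∈ C, ∀ s : Finset ι, {i | x ∈ U i} = s →
        ∃ V ∈ 𝓝 x, ∀ t, (D t ∩ V).Nonempty → t = s := by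
      intro x hx s hs
      refine ⟨⋂ i ∈ s, U i, (isOpen_biInter_finset fun i _ => hU i).mem_nhds
        (mem_iInter₂.2 fun i hi => by
          have : i ∈ {i | x ∈ U i} := hs ▸ (Finset.mem_coe.2 hi)
          exact this), ?_⟩
      rintro t ⟨y, ⟨hyC, hyt⟩, hyV⟩
      have hst : s ⊆ t := fun i hi => by
        have : i ∈ {i | y ∈ U i} := mem_iInter₂.1 hyV i hi
        rw [hyt] at this
        exact this
      refine (Finset.eq_of_subset_of_card_le hst ?_).symm
      have h1 := hcard x hx
      have h2 := hcard y hyC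
      rw [hs, Set.encard_coe_eq_coe_finsetCard] at h1
      rw [hyt, Set.encard_coe_eq_coe_finsetCard, ← h1] at h2
      exact (Nat.cast_injective h2).le
    have hDd : IsDiscreteFamily D := by
      intro x
      by_cases hx : x ∈ C
      · obtain ⟨s, hs⟩ := hfin x hx
        obtain ⟨V, hV, h⟩ := hloc x hx s hs
        exact ⟨V, hV, fun t ht t' ht' => (h t ht).trans (h t' ht').symm⟩
      · refine ⟨Cᶜ, hCc.isOpen_compl.mem_nhds hx, ?_⟩
        rintro t ⟨y, hy, hy'⟩
        exact absurd hy.1 hy'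
    have hDc : ∀ s, IsClosed (D s) := by
      intro s
      rw [← isOpen_compl_iff, isOpen_iff_mem_nhds]
      intro x hx
      by_cases hxC : x ∈ C
      · obtain ⟨t, ht⟩ := hfin x hxC
        obtain ⟨V, hV, h⟩ := hloc x hxC t ht
        filter_upwards [hV] with y hyV hy
        have := h s ⟨y, hy, hyV⟩
        subst this
        exact hx ⟨hxC, ht⟩
      · filter_upwards [hCc.isOpen_compl.mem_nhds hxC] with y hyC hy
        exact hyC hy.1
    let W : Finset ι → Set X := fun s => {x | s.Nonempty ∧ ∀ i ∈ s, x ∈ U i}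
    have hWo : ∀ s, IsOpen (W s) := by
      intro s
      have : W s = {x | s.Nonempty} ∩ ⋂ i ∈ s, U i := by
        ext x
        simp [W]
      rw [this]
      exact isOpen_const.inter (isOpen_biInter_finset fun i _ => hU i)
    have hDW : ∀ s, D s ⊆ W s := by
      rintro s x ⟨-, hx⟩
      refine ⟨?_, fun i hi => ?_⟩
      · obtain ⟨i, hi⟩ := mem_iUnion.1 (hc.ge (mem_univ x))
        have : i ∈ (s : Set ι) := hx ▸ (show i ∈ {i | x ∈ U i} from hi)
        exact ⟨i, this⟩
      · have : i ∈ {i | x ∈ U i} := hx ▸ (Finset.mem_coe.2 hi)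
        exact this
    obtain ⟨g, hg0, hglf, hgs, hgD⟩ := hX.exists_continuous_expansion hDc hDd hWo hDW
    have hsum : ∀ s x, (f s + g s) x ≠ 0 ↔ f s x ≠ 0 ∨ g s x ≠ 0 := by
      intro s x
      rw [ContinuousMap.add_apply, Ne, add_eq_zero_iff_of_nonneg (hf0 s x) (hg0 s x)]
      tauto
    refine ⟨fun s => f s + g s, fun s x => add_nonneg (hf0 s x) (hg0 s x), ?_, ?_, ?_⟩
    · intro x
      obtain ⟨V, hV, hVf⟩ := hflf x
      obtain ⟨V', hV', hVf'⟩ := hglf x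
      refine ⟨V ∩ V', Filter.inter_mem hV hV', (hVf.union hVf').subset ?_⟩
      rintro s ⟨y, hy, hyV, hyV'⟩
      exact ((hsum s y).1 hy).imp (fun h => ⟨y, h, hyV⟩) (fun h => ⟨y, h, hyV'⟩)
    · intro s x hx
      exact ((hsum s x).1 hx).elim (fun h => hfs s h) (fun h => hgs s h)
    · intro x hx
      by_cases hxO : x ∈ O
      · obtain ⟨s, hs⟩ := mem_iUnion.1 hxO
        exact mem_iUnion.2 ⟨s, (hsum s x).2 (Or.inl hs)⟩
      · obtain ⟨s, hs⟩ := hfin x ⟨hx, hxO⟩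
        exact mem_iUnion.2 ⟨s, (hsum s x).2 (Or.inr (hgD s ⟨⟨hx, hxO⟩, hs⟩))⟩

/-- A countable union of locally finite families of cozero sets which covers the space has a
locally finite open precise refinement. -/
theorem exists_locallyFinite_refinement_of_cozero {κ : Type*} (f : ℕ → κ → C(X, ℝ))
    (hf0 : ∀ n k x, 0 ≤ f n k x) (hlf : ∀ n, LocallyFinite fun k => Function.support (f n k))
    (hc : ∀ x, ∃ n k, f n k x ≠ 0) :
    ∃ V : ℕ × κ → Set X, (∀ p, IsOpen (V p)) ∧ LocallyFinite V ∧ ⋃ p, V p = univ ∧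
      ∀ p, V p ⊆ Function.support (f p.1 p.2) := by
  let F : ℕ → X → ℝ := fun n x => ∑ᶠ k, f n k x
  have hFc : ∀ n, Continuous (F n) := fun n =>
    continuous_finsum (fun k => (f n k).continuous) (hlf n)
  have hF0 : ∀ n x, 0 ≤ F n x := fun n x => finsum_nonneg fun k => hf0 n k x
  have hfF : ∀ n k x, f n k x ≤ F n x := fun n k x =>
    single_le_finsum k ((hlf n).point_finite x) fun k => hf0 n k x
  -- At the first stage where some `f n k` is nonzero, the sum vanishes and the point is covered.
  -- Later, the growing factor against the cap `1` forces `V p` away from any point where an earlier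
  -- `F` is bounded below.
  let V : ℕ × κ → Set X := fun p =>
    {x | (p.1 : ℝ) * ∑ m ∈ Finset.range p.1, F m x < min 1 (f p.1 p.2 x)}
  have hVsupp : ∀ p, V p ⊆ Function.support (f p.1 p.2) := by
    rintro p x hx h
    have h1 : (0 : ℝ) ≤ p.1 * ∑ m ∈ Finset.range p.1, F m x :=
      mul_nonneg (Nat.cast_nonneg _) (Finset.sum_nonneg fun m _ => hF0 m x)
    have h2 : (p.1 : ℝ) * ∑ m ∈ Finset.range p.1, F m x < min 1 (f p.1 p.2 x) := hx
    have h3 := h2.trans_le (min_le_right _ _)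
    rw [h] at h3
    exact absurd h3 (not_lt.2 h1)
  refine ⟨V, fun p => ?_, ?_, ?_, hVsupp⟩
  · exact isOpen_lt (continuous_const.mul (continuous_finsetSum _ fun m _ => hFc m))
      (continuous_const.min (f p.1 p.2).continuous)
  · intro x
    obtain ⟨n, k, hnk⟩ := hc x
    have hpos : 0 < F n x := lt_of_lt_of_le (lt_of_le_of_ne (hf0 n k x) hnk.symm) (hfF n k x)
    -- Near `x`, `F n > F n x / 2`; a stage `m ≥ N` with `m > n` would give `m * ∑ F > 1`.
    obtain ⟨N, hN⟩ := exists_nat_gt (1 / (F n x / 2))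
    choose T hT hTf using fun m => hlf m x
    refine ⟨{y | F n x / 2 < F n y} ∩ ⋂ m ∈ Finset.range (max N (n + 1)), T m,
      Filter.inter_mem ((isOpen_lt continuous_const (hFc n)).mem_nhds (by
        show F n x / 2 < F n x
        linarith)) ((Filter.biInter_finset_mem _).2 fun m _ => hT m),
      ((Finset.range (max N (n + 1))).finite_toSet.biUnion fun m _ =>
        (hTf m).image (Prod.mk m)).subset ?_⟩
    rintro ⟨m, k'⟩ ⟨y, hy, hyF, hyT⟩
    by_cases hm : m < max N (n + 1)
    · exact mem_iUnion₂.2 ⟨m, by simpa using hm, k', ⟨y, hVsupp _ hy,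
        mem_iInter₂.1 hyT m (by simpa using hm)⟩, rfl⟩
    · exfalso
      have hNm : N ≤ m := by omega
      have hnm : n < m := by omega
      have h1 : F n y ≤ ∑ j ∈ Finset.range m, F j y :=
        Finset.single_le_sum (f := fun j => F j y) (fun j _ => hF0 j y) (Finset.mem_range.2 hnm)
      have h2 : (m : ℝ) * ∑ j ∈ Finset.range m, F j y < 1 :=
        lt_of_lt_of_le (show _ < _ from hy) (min_le_left _ _)
      have h3 : F n x / 2 < F n y := hyF
      rw [div_lt_iff₀ (by linarith)] at hN
      have h4 : (N : ℝ) ≤ m := by exact_mod_cast hNm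
      have h5 : (N : ℝ) * (F n x / 2) ≤ m * ∑ j ∈ Finset.range m, F j y :=
        mul_le_mul h4 (by linarith) (by linarith) (Nat.cast_nonneg m)
      linarith
  · classical
    refine eq_univ_of_forall fun x => mem_iUnion.2 ?_
    have hx := hc x
    obtain ⟨k, hk⟩ := Nat.find_spec hx
    refine ⟨(Nat.find hx, k), ?_⟩
    have hz : ∑ m ∈ Finset.range (Nat.find hx), F m x = 0 :=
      Finset.sum_eq_zero fun m hm => by
        have := Nat.find_min hx (Finset.mem_range.1 hm)
        push Not at this
        simp [F, this]
    show (Nat.find hx : ℝ) * ∑ m ∈ Finset.range (Nat.find hx), F m x < min 1 (f (Nat.find hx) k x)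
    rw [hz, mul_zero]
    exact lt_min one_pos (lt_of_le_of_ne (hf0 _ _ _) (Ne.symm hk))

/-- An open cover of a collectionwise normal space that has a member containing all points of
infinite order has a locally finite open refinement. -/
theorem IsCollectionwiseNormal.exists_locallyFinite_refinement (hX : IsCollectionwiseNormal X)
    (hU : ∀ i, IsOpen (U i)) (hc : ⋃ i, U i = univ) (i₀ : ι)
    (hi₀ : ∀ x, {i | x ∈ U i}.Infinite → x ∈ U i₀) :
    ∃ V : ℕ × Finset ι → Set X, (∀ p, IsOpen (V p)) ∧ LocallyFinite V ∧ ⋃ p, V p = univ ∧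
      ∀ p, ∃ i, V p ⊆ U i := by
  classical
  have := hX.normalSpace
  choose f hf0 hflf hfs hfc using hX.exists_cozero_cover_encard_le hU hc
  set O : Set X := ⋃ n, ⋃ s, Function.support (f n s) with hO
  have hOo : IsOpen O := isOpen_iUnion fun n => isOpen_iUnion fun s =>
    isOpen_ne_fun (f n s).continuous continuous_const
  -- Points of finite order lie in `O`, so `Oᶜ` is contained in `U i₀`.
  have hOU : Disjoint (U i₀)ᶜ Oᶜ := by
    refine Set.disjoint_left.2 fun x hx hxO => hx (hi₀ x fun hfin => hxO ?_)
    obtain ⟨n, hn⟩ := ENat.ne_top_iff_exists.1 (Set.encard_ne_top_iff.2 hfin)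
    exact mem_iUnion.2 ⟨n, hfc n hn.ge⟩
  obtain ⟨u, hu0, hu1, hu⟩ := exists_continuous_zero_one_of_isClosed (hU i₀).isClosed_compl
    hOo.isClosed_compl hOU
  -- Stage `0` consists of `u` alone, which covers `Oᶜ`; the order-`n` family becomes stage `n + 1`.
  let g : ℕ → Finset ι → C(X, ℝ) := fun n => Nat.casesOn n (fun s => if s = {i₀} then u else 0) f
  obtain ⟨V, hVo, hVlf, hVc, hVg⟩ := exists_locallyFinite_refinement_of_cozero g
    (by
      rintro (_ | n) s x
      · by_cases h : s = {i₀}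
        · simpa [g, h] using (hu x).1
        · simp [g, h]
      · exact hf0 n s x)
    (by
      rintro (_ | n)
      · refine fun x => ⟨univ, Filter.univ_mem, (finite_singleton {i₀}).subset ?_⟩
        rintro s ⟨y, hy, -⟩
        by_contra h
        exact hy (by simp [g, show s ≠ {i₀} from h])
      · exact hflf n)
    (by
      intro x
      by_cases hx : x ∈ O
      · obtain ⟨n, s, h⟩ := mem_iUnion₂.1 hx
        exact ⟨n + 1, s, h⟩
      · refine ⟨0, {i₀}, ?_⟩
        have := hu1 hx
        simp only [Pi.one_apply] at this
        simp [g, this])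
  refine ⟨V, hVo, hVlf, hVc, ?_⟩
  rintro ⟨_ | n, s⟩
  · refine ⟨i₀, fun x hx => ?_⟩
    have h := hVg _ hx
    by_cases hs : s = {i₀}
    · by_contra hxU
      have := hu0 hxU
      simp [g, hs, this] at h
    · simp [g, hs] at h
  · by_cases hs : s.Nonempty
    · exact ⟨hs.choose, fun x hx => (hfs n s (hVg _ hx)).2 _ hs.choose_spec⟩
    · exact ⟨i₀, fun x hx => absurd (hfs n s (hVg _ hx)).1 hs⟩

end Order

/-! ### Approximate selections and their limit. -/

section Selection

variable {X E : Type*} [TopologicalSpace X] [NormedAddCommGroup E]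

/-- Subtracting an approximate selection recentres it at `0`, so that the ball to be met no longer
depends on `x`. -/
theorem lowerHemicontinuous_translate {φ : X → Set E} (hφ : LowerHemicontinuous φ) {g : X → E}
    (hg : Continuous g) : LowerHemicontinuous fun x => {y | y + g x ∈ φ x} := by
  rw [lowerHemicontinuous_iff_isOpen_inter_nonempty] at hφ ⊢
  intro W hW
  rw [isOpen_iff_mem_nhds]
  rintro x ⟨y, hy, hyW⟩
  obtain ⟨δ, hδ, hδW⟩ := Metric.isOpen_iff.1 hW y hyW
  have h1 := (hφ _ (Metric.isOpen_ball (x := y + g x) (ε := δ / 2))).mem_nhds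
    ⟨y + g x, hy, Metric.mem_ball_self (half_pos hδ)⟩
  have h2 := hg.continuousAt.preimage_mem_nhds (Metric.ball_mem_nhds (g x) (half_pos hδ))
  filter_upwards [h1, h2] with x' h1' h2'
  obtain ⟨z, hz, hzb⟩ := h1'
  refine ⟨z - g x', by simpa using hz, hδW ?_⟩
  rw [mem_preimage, mem_ball_iff_norm] at h2'
  rw [mem_ball_iff_norm] at hzb ⊢
  calc ‖z - g x' - y‖ = ‖(z - (y + g x)) - (g x' - g x)‖ := by congr 1; abel
    _ ≤ ‖z - (y + g x)‖ + ‖g x' - g x‖ := norm_sub_le _ _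
    _ < δ := by linarith

theorem translate_mem_compactOrWholeFamily {S : Set E} (hS : S ∈ compactOrWholeFamily E) (v : E) :
    {y | y + v ∈ S} ∈ compactOrWholeFamily E := by
  rcases hS with ⟨⟨⟨z, hz⟩, hcl⟩, hco⟩ | rfl
  · exact Or.inl ⟨⟨⟨z - v, by simpa using hz⟩, hcl.preimage (continuous_add_const v)⟩,
      (Homeomorph.addRight v).isCompact_preimage.2 hco⟩
  · exact Or.inr (by simp)

theorem isClosed_of_mem_compactOrWholeFamily {S : Set E} (hS : S ∈ compactOrWholeFamily E) :
    IsClosed S := by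
  rcases hS with h | rfl
  · exact h.1.2
  · exact isClosed_univ

variable [NormedSpace ℝ E]

/-- An approximate selection for the convex-valued mapping `x ↦ φ x ∩ G`. -/
theorem IsCollectionwiseNormal.exists_approx_selection (hX : IsCollectionwiseNormal X)
    {φ : X → Set E} (hφ : ∀ x, φ x ∈ compactOrWholeFamily E) (hl : LowerHemicontinuous φ)
    (hconv : ∀ x, Convex ℝ (φ x)) {G : Set E} (hGo : IsOpen G) (hGc : Convex ℝ G)
    (hG0 : (0 : E) ∈ G) (hφG : ∀ x, (φ x ∩ G).Nonempty) {ε : ℝ} (hε : 0 < ε) :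
    ∃ g : X → E, Continuous g ∧ ∀ x, ∃ y ∈ φ x ∩ G, dist (g x) y < ε := by
  have := hX.normalSpace
  obtain ⟨v, hvo, hvc, hvlf, hvb⟩ := precise_refinement (fun e : E => Metric.ball e ε)
    (fun _ => Metric.isOpen_ball)
    (eq_univ_of_forall fun e => mem_iUnion.2 ⟨e, Metric.mem_ball_self hε⟩)
  obtain ⟨e₀, he₀⟩ := mem_iUnion.1 (hvc.ge (mem_univ (0 : E)))
  let U : E → Set X := fun e => {x | (φ x ∩ (v e ∩ G)).Nonempty}
  have hU : ∀ e, IsOpen (U e) := fun e =>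
    lowerHemicontinuous_iff_isOpen_inter_nonempty.1 hl _ ((hvo e).inter hGo)
  have hUc : ⋃ e, U e = univ := eq_univ_of_forall fun x => by
    obtain ⟨y, hy, hyG⟩ := hφG x
    obtain ⟨e, he⟩ := mem_iUnion.1 (hvc.ge (mem_univ y))
    exact mem_iUnion.2 ⟨e, y, hy, he, hyG⟩
  -- Where `φ x = E`, the point `0 ∈ v e₀ ∩ G` is a value common to all such `x`.
  have hinf : ∀ x, {e | x ∈ U e}.Infinite → x ∈ U e₀ := by
    intro x hx
    rcases hφ x with h | h
    · refine absurd ((hvlf.finite_nonempty_inter_compact h.2).subset ?_) hx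
      rintro e ⟨y, hy, hyv, -⟩
      exact ⟨y, hyv, hy⟩
    · exact ⟨0, by rw [mem_singleton_iff.1 h]; trivial, he₀, hG0⟩
  obtain ⟨V, hVo, hVlf, hVc, hVU⟩ := hX.exists_locallyFinite_refinement hU hUc e₀ hinf
  choose e he using hVU
  obtain ⟨ρ, hρ⟩ := PartitionOfUnity.exists_isSubordinate_of_locallyFinite isClosed_univ V hVo
    hVlf hVc.ge
  refine ⟨fun x => ∑ᶠ p, ρ p x • e p, ρ.continuous_finsum_smul fun p x _ => continuousAt_const,
    fun x => ?_⟩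
  -- The thickening is convex, and it contains each `e p` of nonzero weight at `x`.
  have hmem : (∑ᶠ p, ρ p x • e p) ∈ Metric.thickening ε (φ x ∩ G) := by
    refine ρ.finsum_smul_mem_convex (g := fun p _ => e p) (mem_univ x) (fun p hp => ?_)
      (((hconv x).inter hGc).thickening ε)
    obtain ⟨y, hy, hyv, hyG⟩ := he p (hρ p (subset_tsupport _ hp))
    exact Metric.mem_thickening_iff.2 ⟨y, ⟨hy, hyG⟩, by
      rw [dist_comm]
      exact hvb _ hyv⟩
  exact Metric.mem_thickening_iff.1 hmem

/-- The improvement of an approximate selection. -/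
theorem IsCollectionwiseNormal.exists_approx_selection_near (hX : IsCollectionwiseNormal X)
    {φ : X → Set E} (hφ : ∀ x, φ x ∈ compactOrWholeFamily E) (hl : LowerHemicontinuous φ)
    (hconv : ∀ x, Convex ℝ (φ x)) {f : X → E} (hf : Continuous f) {δ ε : ℝ} (hδ : 0 < δ)
    (hε : 0 < ε) (hfφ : ∀ x, ∃ y ∈ φ x, dist (f x) y < δ) :
    ∃ g : X → E, Continuous g ∧ (∀ x, ∃ y ∈ φ x, dist (g x) y < ε) ∧
      ∀ x, dist (f x) (g x) ≤ δ + ε := by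
  obtain ⟨h, hc, hh⟩ := hX.exists_approx_selection (φ := fun x => {y | y + f x ∈ φ x})
    (fun x => translate_mem_compactOrWholeFamily (hφ x) (f x))
    (lowerHemicontinuous_translate hl hf)
    (fun x => (hconv x).translate_preimage_left (f x))
    Metric.isOpen_ball (convex_ball (0 : E) δ) (Metric.mem_ball_self hδ)
    (fun x => by
      obtain ⟨y, hy, hyd⟩ := hfφ x
      refine ⟨y - f x, by simpa using hy, ?_⟩
      rwa [mem_ball_zero_iff, ← dist_eq_norm, dist_comm]) hε
  refine ⟨fun x => h x + f x, hc.add hf, fun x => ?_, fun x => ?_⟩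
  · obtain ⟨y, ⟨hy, -⟩, hyd⟩ := hh x
    exact ⟨y + f x, hy, by rwa [dist_add_right]⟩
  · obtain ⟨y, ⟨-, hy⟩, hyd⟩ := hh x
    rw [mem_ball_zero_iff] at hy
    rw [dist_eq_norm] at hyd ⊢
    calc ‖f x - (h x + f x)‖ = ‖(h x - y) + y‖ := by
          rw [← norm_neg]
          congr 1
          abel
      _ ≤ ‖h x - y‖ + ‖y‖ := norm_add_le _ _
      _ ≤ δ + ε := by linarith

/-- The selection theorem for lower semicontinuous convex-valued mappings of a collectionwise
normal space whose values are compact or the whole Banach space. -/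
theorem IsCollectionwiseNormal.exists_continuous_selection [CompleteSpace E]
    (hX : IsCollectionwiseNormal X)
    {φ : X → Set E} (hφ : ∀ x, φ x ∈ compactOrWholeFamily E) (hl : LowerHemicontinuous φ)
    (hconv : ∀ x, Convex ℝ (φ x)) : ∃ f : X → E, Continuous f ∧ IsSelection f φ := by
  let P : ℕ → (X → E) → Prop := fun n f =>
    Continuous f ∧ ∀ x, ∃ y ∈ φ x, dist (f x) y < (1 / 2 : ℝ) ^ n
  have hne : ∀ x, (φ x).Nonempty := fun x => by
    rcases hφ x with h | h
    · exact h.1.1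
    · exact ⟨0, by rw [mem_singleton_iff.1 h]; trivial⟩
  have h0 : ∃ f, P 0 f := by
    obtain ⟨f, hf, h⟩ := hX.exists_approx_selection hφ hl hconv isOpen_univ convex_univ
      (mem_univ 0) (by simpa using hne) one_pos
    exact ⟨f, hf, fun x => by
      obtain ⟨y, hy, hd⟩ := h x
      exact ⟨y, hy.1, by simpa using hd⟩⟩
  -- The step size is at most `(1 / 2) ^ n + (1 / 2) ^ (n + 1)`.
  have hstep : ∀ n (f : {f // P n f}), ∃ g : {g // P (n + 1) g},
      ∀ x, dist (f.1 x) (g.1 x) ≤ 2 * (1 / 2 : ℝ) ^ n := by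
    rintro n ⟨f, hf, h⟩
    obtain ⟨g, hg, hgφ, hgd⟩ := hX.exists_approx_selection_near hφ hl hconv hf
      (δ := (1 / 2 : ℝ) ^ n) (ε := (1 / 2 : ℝ) ^ (n + 1)) (by positivity) (by positivity) h
    refine ⟨⟨g, hg, hgφ⟩, fun x => (hgd x).trans ?_⟩
    have : (0 : ℝ) < (1 / 2) ^ n := by positivity
    rw [pow_succ]
    linarith
  choose next hnext using hstep
  let F : ∀ n, {f // P n f} := fun n => Nat.rec ⟨h0.choose, h0.choose_spec⟩ next n
  have hF : ∀ x n, dist ((F n).1 x) ((F (n + 1)).1 x) ≤ 2 * (1 / 2 : ℝ) ^ n :=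
    fun x n => hnext n (F n) x
  have hlim : ∀ x, ∃ y, Filter.Tendsto (fun n => (F n).1 x) Filter.atTop (𝓝 y) := fun x =>
    cauchySeq_tendsto_of_complete (cauchySeq_of_le_geometric _ _ (by norm_num) (hF x))
  choose f hf using hlim
  have hdist : ∀ n x, dist ((F n).1 x) (f x) ≤ 2 * (1 / 2 : ℝ) ^ n / (1 - 1 / 2) := fun n x =>
    dist_le_of_le_geometric_of_tendsto _ _ (by norm_num) (hF x) (hf x) n
  have hpow : Filter.Tendsto (fun n : ℕ => (1 / 2 : ℝ) ^ n) Filter.atTop (𝓝 0) :=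
    tendsto_pow_atTop_nhds_zero_of_lt_one (by norm_num) (by norm_num)
  have hsmall : Filter.Tendsto (fun n : ℕ => 2 * (1 / 2 : ℝ) ^ n / (1 - 1 / 2)) Filter.atTop
      (𝓝 0) := by
    simpa using (hpow.const_mul 2).div_const (1 - 1 / 2)
  refine ⟨f, ?_, fun x => ?_⟩
  · have hunif : TendstoUniformly (fun n => (F n).1) f Filter.atTop := by
      rw [Metric.tendstoUniformly_iff]
      intro ε hε
      filter_upwards [hsmall.eventually (gt_mem_nhds hε)] with n hn x
      rw [dist_comm]
      exact (hdist n x).trans_lt hn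
    exact hunif.continuous (Filter.Frequently.of_forall fun n => (F n).2.1)
  · choose y hy hyd using fun n => (F n).2.2 x
    refine (isClosed_of_mem_compactOrWholeFamily (hφ x)).mem_of_tendsto (f := y)
      (b := Filter.atTop) ?_ (Filter.Eventually.of_forall hy)
    -- The nearby points `y n` of `φ x` have the same limit as `F n x`.
    refine (hf x).congr_dist ?_
    exact squeeze_zero (fun n => dist_nonneg) (fun n => (hyd n).le) hpow

end Selection

theorem theorem1p2 (E : Type u) [NormedAddCommGroup E] [NormedSpace ℝ E] [CompleteSpace E] :
    (∀ (X : Type v) [TopologicalSpace X], IsCollectionwiseNormal X →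
      ∀ φ : X → Set E, (∀ x, φ x ∈ compactFamily E) → LowerHemicontinuous φ →
        (∀ x, Convex ℝ (φ x)) → ∃ f : X → E, Continuous f ∧ IsSelection f φ) ↔
    (∀ (X : Type v) [TopologicalSpace X], IsCollectionwiseNormal X →
      ∀ φ : X → Set E, (∀ x, φ x ∈ compactOrWholeFamily E) → LowerHemicontinuous φ →
        (∀ x, Convex ℝ (φ x)) → ∃ f : X → E, Continuous f ∧ IsSelection f φ) :=
  ⟨fun _ _ _ hX _ hφ hl hconv => hX.exists_continuous_selection hφ hl hconv,
    fun h X _ hX φ hφ => h X hX φ fun x => Or.inl (hφ x)⟩
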